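/- Let $X$ be a real Banach space with dual $X^*$ and bidual $X^{**}$, where $X$ is identified with its canonical image in $X^{**}$. Let $(f_k)_{k\ge 1}$ be a sequence of proper, convex, lower semicontinuous functions $f_k:X\to\mathbb{R}\cup\{+\infty\}$. Put $f:=\sup_{k\ge1}f_k$ and $f_\infty(x):=\limsup_{k\to\infty}f_k(x)\in[-\infty,+\infty]$ for $x\in X$, and suppose that there is a point of $X$ at which $f$ is finite and continuous. For $g:X\to[-\infty,+\infty]$ let $g^*(x^*):=\sup_{x\in X}\{\langle x^*,x\rangle-g(x)\}$, $x^*\in X^*$, and $g^{**}(z):=\sup_{x^*\in X^*}\{\langle z,x^*\rangle-g^*(x^*)\}$, $z\in X^{**}$. Then, for every $z\in X^{**}$, $$f^{**}(z)=\max\Big\{\sup_{k\ge1}f_k^{**}(z),\ f_\infty^{**}(z)\Big\}+\mathrm{I}_{\overline{\operatorname{dom} f}^{\,w^{**}}}(z),$$ where $\operatorname{dom} f:=\{x\in X: f(x)<+\infty\}$, $\overline{\operatorname{dom} f}^{\,w^{**}}$ is its closure in $X^{**}$ for the weak-* topology $\sigma(X^{**},X^*)$, and $\mathrm{I}_A$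 is $0$ on $A$ and $+\infty$ outside $A$. -/

import Mathlib

open Filter Topology

noncomputable section

/-- The effective domain of an extended-real-valued function. -/
def effDom {E : Type*} (f : E → EReal) : Set E := {x | f x < ⊤}

/-- The epigraph, a subset of the product with the real line. -/
def epi {E : Type*} (f : E → EReal) : Set (E × ℝ) := {p | f p.1 ≤ (p.2 : EReal)}

/-- The class of proper, convex and lower semicontinuous functions on a real normed space. -/
structure IsGammaZero {E : Type*} [NormedAddCommGroup E] [NormedSpace ℝ E] (f : E → EReal) :
    Prop where
  ne_bot : ∀ x, f x ≠ ⊥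
  exists_ne_top : ∃ x, f x ≠ ⊤
  convex_epi : Convex ℝ (epi f)
  lsc : LowerSemicontinuous f

/-- The Fenchel conjugate, a function on the topological dual. -/
def conj {E : Type*} [NormedAddCommGroup E] [NormedSpace ℝ E] (f : E → EReal) :
    StrongDual ℝ E → EReal :=
  fun φ => ⨆ x : E, ((φ x : ℝ) : EReal) - f x

/-- The Fenchel biconjugate: the conjugate of the conjugate, a function on the bidual. -/
def biconj {E : Type*} [NormedAddCommGroup E] [NormedSpace ℝ E] (f : E → EReal) :
    StrongDual ℝ (StrongDual ℝ E) → EReal :=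
  conj (conj f)

/-- The convex-analytic indicator function: zero on the set and plus infinity outside of it. -/
def indicatorFun {E : Type*} (A : Set E) : E → EReal :=
  open Classical in fun x => if x ∈ A then 0 else ⊤

/-- The closure in the bidual, for its weak-star topology (pointwise convergence on the dual), of
a subset of the space, the space being identified with its canonical image in the bidual. -/
def wStarClosure {E : Type*} [NormedAddCommGroup E] [NormedSpace ℝ E] (A : Set E) :
    Set (StrongDual ℝ (StrongDual ℝ E)) :=
  {z | StrongDual.toWeakDual z ∈ closure
    ((fun x : E => StrongDual.toWeakDual (NormedSpace.inclusionInDoubleDual ℝ E x)) '' A)}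

/-- Finite and continuous at a point (for the usual topology of the extended reals). -/
def FiniteContinuousAt {E : Type*} [TopologicalSpace E] (f : E → EReal) (x : E) : Prop :=
  f x ≠ ⊥ ∧ f x ≠ ⊤ ∧ ContinuousAt f x

end

/-! Off the weak-star closure of dom f a separating functional makes both sides +∞, and on it `≥` is
monotonicity of biconjugation. For `≤`, let φ - β minorize f. By Hahn–Banach, (φ, β) is a pointwise
limit of finite convex combinations of minorants of the f_k. An upper bound for f on a ball bounds
the component of each index k, so by Banach–Alaoglu it converges along an ultrafilter to some d_k in
the cone of f_k. Weights may vanish in the limit, which is why weight 0 is admitted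
(`exists_minorant_sequence`).

The same bound makes ∑ d_k converge in norm (`summable_of_tails_mem_minorantCone`). What is left
over minorizes every tail supremum, hence belongs to limsup f_k. Since z is norm continuous on the
dual, it can be applied termwise: a piece of weight l contributes at most l * a, by
`apply_sub_le_of_mem_minorantCone`, and the weights add up to 1. -/

/-- The convex cone of triples `(l, u, b)` for which `u - b` is an affine minorant of `l • h`, where
`0 • h` is read as the indicator function of the effective domain of `h`. -/
def minorantCone {X : Type*} [NormedAddCommGroup X] [NormedSpace ℝ X] (h : X → EReal) :
    Set (ℝ × StrongDual ℝ X × ℝ) :=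
  {p | 0 ≤ p.1 ∧ ∀ (x : X) (r : ℝ), h x ≤ r → p.2.1 x - p.2.2 ≤ p.1 * r}

/-! ### Affine minorants and their values at points of the bidual. -/

section Minorants

variable {X : Type*} [NormedAddCommGroup X] [NormedSpace ℝ X]

theorem zero_mem_minorantCone (h : X → EReal) : 0 ∈ minorantCone h := by
  simp [minorantCone]

theorem add_mem_minorantCone {h : X → EReal} {p q : ℝ × StrongDual ℝ X × ℝ}
    (hp : p ∈ minorantCone h) (hq : q ∈ minorantCone h) : p + q ∈ minorantCone h := by
  refine ⟨add_nonneg hp.1 hq.1, fun x r hr => ?_⟩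
  have h1 := hp.2 x r hr
  have h2 := hq.2 x r hr
  simp only [Prod.snd_add, Prod.fst_add, add_apply]
  linarith

theorem smul_mem_minorantCone {h : X → EReal} {p : ℝ × StrongDual ℝ X × ℝ} {c : ℝ} (hc : 0 ≤ c)
    (hp : p ∈ minorantCone h) : c • p ∈ minorantCone h := by
  refine ⟨mul_nonneg hc hp.1, fun x r hr => ?_⟩
  have h1 := mul_le_mul_of_nonneg_left (hp.2 x r hr) hc
  simp only [Prod.smul_snd, Prod.smul_fst, smul_apply, smul_eq_mul]
  linarith

theorem sum_mem_minorantCone {ι : Type*} {h : X → EReal} (s : Finset ι)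
    {d : ι → ℝ × StrongDual ℝ X × ℝ} (hd : ∀ i ∈ s, d i ∈ minorantCone h) :
    ∑ i ∈ s, d i ∈ minorantCone h :=
  Finset.sum_induction _ (· ∈ minorantCone h) (fun _ _ => add_mem_minorantCone)
    (zero_mem_minorantCone h) hd

theorem minorantCone_mono {h h' : X → EReal} (hh : h ≤ h') :
    minorantCone h ⊆ minorantCone h' :=
  fun _ hp => ⟨hp.1, fun x r hr => hp.2 x r ((hh x).trans hr)⟩

/-- Each defining inequality involves a single evaluation of `u`, so weak-star convergence suffices.
-/
theorem mem_minorantCone_of_tendsto {ι : Type*} {l : Filter ι} [l.NeBot] {h : X → EReal}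
    {d : ι → ℝ × StrongDual ℝ X × ℝ} {p : ℝ × StrongDual ℝ X × ℝ}
    (hd : ∀ᶠ i in l, d i ∈ minorantCone h) (h1 : Tendsto (fun i => (d i).1) l (𝓝 p.1))
    (h2 : ∀ x, Tendsto (fun i => (d i).2.1 x) l (𝓝 (p.2.1 x)))
    (h3 : Tendsto (fun i => (d i).2.2) l (𝓝 p.2.2)) : p ∈ minorantCone h :=
  ⟨ge_of_tendsto h1 (hd.mono fun _ hi => hi.1), fun x r hr =>
    le_of_tendsto_of_tendsto ((h2 x).sub h3) (h1.mul_const r) (hd.mono fun _ hi => hi.2 x r hr)⟩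

theorem conj_le_of_mem_minorantCone {h : X → EReal} {u : StrongDual ℝ X} {b : ℝ}
    (hp : ((1 : ℝ), u, b) ∈ minorantCone h) : conj h u ≤ b := by
  refine iSup_le fun x => ?_
  have key := hp.2 x
  induction hx : h x with
  | bot =>
    have := key (u x - b - 1) (by simp [hx])
    simp only at this
    linarith
  | top => simp
  | coe r =>
    have := key r (by simp [hx])
    rw [← EReal.coe_sub, EReal.coe_le_coe_iff]
    simp only at this
    linarith

theorem mem_minorantCone_of_conj_le {h : X → EReal} {u : StrongDual ℝ X} {b : ℝ}
    (hp : conj h u ≤ b) : ((1 : ℝ), u, b) ∈ minorantCone h := by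
  refine ⟨zero_le_one, fun x r hr => ?_⟩
  have h1 : ((u x : ℝ) : EReal) - h x ≤ b := (le_iSup (fun x => ((u x : ℝ) : EReal) - h x) x).trans hp
  have h2 : ((u x : ℝ) : EReal) - r ≤ b := (EReal.sub_le_sub le_rfl hr).trans h1
  rw [← EReal.coe_sub, EReal.coe_le_coe_iff] at h2
  simp only
  linarith

theorem conj_antitone {E : Type*} [NormedAddCommGroup E] [NormedSpace ℝ E] {g h : E → EReal}
    (hgh : g ≤ h) : conj h ≤ conj g :=
  fun _ => iSup_mono fun x => EReal.sub_le_sub le_rfl (hgh x)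

theorem biconj_mono {g h : X → EReal} (hgh : g ≤ h) : biconj g ≤ biconj h :=
  conj_antitone (conj_antitone hgh)

theorem le_biconj_of_mem_minorantCone {h : X → EReal} {u : StrongDual ℝ X} {b : ℝ}
    (hp : ((1 : ℝ), u, b) ∈ minorantCone h) (z : StrongDual ℝ (StrongDual ℝ X)) :
    ((z u - b : ℝ) : EReal) ≤ biconj h z := by
  rw [EReal.coe_sub]
  exact (EReal.sub_le_sub le_rfl (conj_le_of_mem_minorantCone hp)).trans
    (le_iSup (fun u => ((z u : ℝ) : EReal) - conj h u) u)

theorem apply_le_of_mem_wStarClosure {A : Set X} {z : StrongDual ℝ (StrongDual ℝ X)}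
    (hz : z ∈ wStarClosure A) {u : StrongDual ℝ X} {b : ℝ} (hb : ∀ x ∈ A, u x ≤ b) : z u ≤ b := by
  have hc : IsClosed {w : WeakDual ℝ (StrongDual ℝ X) | w u ≤ b} :=
    isClosed_le (WeakDual.eval_continuous u) continuous_const
  refine closure_minimal ?_ hc hz
  rintro _ ⟨x, hx, rfl⟩
  exact hb x hx

/-- Positive weights rescale to 1. Weight 0 gives `u ≤ b` on `A`, which passes to the weak-star
closure; only this case uses `hz`. -/
theorem apply_sub_le_of_mem_minorantCone {h : X → EReal} {A : Set X} (hA : A ⊆ effDom h)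
    {z : StrongDual ℝ (StrongDual ℝ X)} (hz : z ∈ wStarClosure A) {a : ℝ} (ha : biconj h z ≤ a)
    {p : ℝ × StrongDual ℝ X × ℝ} (hp : p ∈ minorantCone h) : z p.2.1 - p.2.2 ≤ p.1 * a := by
  obtain ⟨l, u, b⟩ := p
  rcases (show (0 : ℝ) ≤ l from hp.1).eq_or_lt with rfl | hl
  · have : z u ≤ b := by
      refine apply_le_of_mem_wStarClosure hz fun x hx => ?_
      obtain ⟨r, hr, -⟩ := EReal.lt_iff_exists_real_btwn.1 (show h x < ⊤ from hA hx)
      have := hp.2 x r hr.le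
      simp only at this
      linarith
    simp only
    linarith
  · have h1 := smul_mem_minorantCone (inv_nonneg.2 hl.le) hp
    have h2 : l⁻¹ • (l, u, b) = ((1 : ℝ), l⁻¹ • u, l⁻¹ * b) := by
      simp [hl.ne']
    rw [h2] at h1
    have h3 := (le_biconj_of_mem_minorantCone h1 z).trans ha
    rw [EReal.coe_le_coe_iff, map_smul, smul_eq_mul, ← mul_sub, inv_mul_le_iff₀ hl] at h3
    exact h3

/-- Weak-star continuous functionals on the dual are evaluations at points of `E`. -/
theorem exists_separating_eval {E : Type*} [NormedAddCommGroup E] [NormedSpace ℝ E]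
    {A : Set (StrongDual ℝ E)} (hA : Convex ℝ A) {ψ : StrongDual ℝ E}
    (hψ : StrongDual.toWeakDual ψ ∉ closure (StrongDual.toWeakDual '' A)) :
    ∃ (e : E) (c : ℝ), (∀ a ∈ A, a e < c) ∧ c < ψ e := by
  have hconv : Convex ℝ (closure (StrongDual.toWeakDual '' A)) :=
    (hA.is_linear_image (StrongDual.toWeakDual (𝕜 := ℝ) (E := E)).isLinear).closure
  have : LocallyConvexSpace ℝ (WeakDual ℝ E) :=
    (WeakDual.withSeminorms (𝕜 := ℝ) (E := E)).toLocallyConvexSpace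
  obtain ⟨F, c, h1, h2⟩ := geometric_hahn_banach_closed_point hconv isClosed_closure hψ
  obtain ⟨e, he⟩ := LinearMap.dualEmbedding_surjective (topDualPairing ℝ E) F
  have hF : ∀ w : WeakDual ℝ E, F w = w e := fun w => by rw [← he]; rfl
  refine ⟨e, c, fun a ha => ?_, ?_⟩
  · have := h1 _ (subset_closure (Set.mem_image_of_mem _ ha))
    rwa [hF] at this
  · rwa [hF] at h2

/-- Separating `z` from the domain gives a weight-0 minorant that is positive at `z`; its multiples
can be added to `p` freely. -/
theorem biconj_eq_top_of_notMem {h : X → EReal} (hconv : Convex ℝ (effDom h))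
    {p : StrongDual ℝ X × ℝ} (hp : ((1 : ℝ), p) ∈ minorantCone h)
    {z : StrongDual ℝ (StrongDual ℝ X)} (hz : z ∉ wStarClosure (effDom h)) : biconj h z = ⊤ := by
  have h1 : Convex ℝ (NormedSpace.inclusionInDoubleDual ℝ X '' effDom h) :=
    hconv.is_linear_image (NormedSpace.inclusionInDoubleDual ℝ X).isLinear
  obtain ⟨v, c, hv, hzv⟩ := exists_separating_eval h1 (ψ := z) (by
    rw [Set.image_image]; exact hz)
  have h0 : ((0 : ℝ), v, c) ∈ minorantCone h := by
    refine ⟨le_rfl, fun x r hr => ?_⟩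
    have : v x < c := hv _ (Set.mem_image_of_mem _ (hr.trans_lt (EReal.coe_lt_top r)))
    simp only
    linarith
  rw [EReal.eq_top_iff_forall_lt]
  intro y
  obtain ⟨n, hn⟩ := exists_nat_gt ((y - (z p.1 - p.2)) / (z v - c))
  rw [div_lt_iff₀ (by linarith)] at hn
  have h2 := add_mem_minorantCone hp (smul_mem_minorantCone (Nat.cast_nonneg n) h0)
  have h3 : ((1 : ℝ), p) + (n : ℝ) • ((0 : ℝ), v, c) = ((1 : ℝ), p.1 + (n : ℝ) • v, p.2 + n * c) := by
    ext <;> simp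
  rw [h3] at h2
  refine lt_of_lt_of_le ?_ (le_biconj_of_mem_minorantCone h2 z)
  rw [EReal.coe_lt_coe_iff, map_add, map_smul, smul_eq_mul]
  linarith

end Minorants

/-! ### Fenchel–Moreau: functions recovered from their affine minorants. -/

section FenchelMoreau

variable {X : Type*} [NormedAddCommGroup X] [NormedSpace ℝ X] {h : X → EReal}

theorem IsGammaZero.isClosed_epi (hh : IsGammaZero h) : IsClosed (epi h) :=
  (lowerSemicontinuous_iff_isClosed_epigraph.1 hh.lsc).preimage
    (continuous_fst.prodMk (continuous_coe_real_ereal.comp continuous_snd))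

theorem IsGammaZero.exists_separating (hh : IsGammaZero h) {x : X} {c : ℝ} (hc : (c : EReal) < h x) :
    ∃ (v : StrongDual ℝ X) (a s : ℝ), 0 ≤ a ∧ (∀ (y : X) (r : ℝ), h y ≤ r → v y - a * r < s) ∧
      s < v x - a * c := by
  obtain ⟨F, s, h1, h2⟩ := geometric_hahn_banach_closed_point hh.convex_epi hh.isClosed_epi
    (x := (x, c)) (by simpa [epi] using hc)
  have hF : ∀ (y : X) (r : ℝ), F (y, r) = F (y, 0) + F (0, 1) * r := by
    intro y r
    have : ((y, r) : X × ℝ) = (y, 0) + r • (0, 1) := by ext <;> simp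
    rw [this, map_add, map_smul, smul_eq_mul, mul_comm]
  have key : ∀ (y : X) (r : ℝ), h y ≤ r → F (y, 0) + F (0, 1) * r < s := by
    intro y r hr
    rw [← hF]
    exact h1 (y, r) hr
  refine ⟨F.comp (ContinuousLinearMap.inl ℝ X ℝ), -F (0, 1), s, ?_, ?_, ?_⟩
  · obtain ⟨y, hy⟩ := hh.exists_ne_top
    obtain ⟨r, hr, -⟩ := EReal.lt_iff_exists_real_btwn.1 hy.lt_top
    by_contra hneg
    have hpos : 0 < F (0, 1) := by linarith
    obtain ⟨n, hn⟩ := exists_nat_gt ((s - (F (y, 0) + F (0, 1) * r)) / F (0, 1))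
    rw [div_lt_iff₀ hpos] at hn
    have := key y (r + n) (hr.le.trans (EReal.coe_le_coe_iff.2 (by simp)))
    nlinarith
  · intro y r hr
    have := key y r hr
    simp only [ContinuousLinearMap.comp_apply, ContinuousLinearMap.inl_apply]
    linarith
  · rw [hF] at h2
    simp only [ContinuousLinearMap.comp_apply, ContinuousLinearMap.inl_apply]
    linarith

theorem mem_minorantCone_of_separating {v : StrongDual ℝ X} {a s : ℝ} (ha : 0 < a)
    (hs : ∀ (y : X) (r : ℝ), h y ≤ r → v y - a * r < s) :
    ((1 : ℝ), a⁻¹ • v, a⁻¹ * s) ∈ minorantCone h := by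
  have : (a, v, s) ∈ minorantCone h := ⟨ha.le, fun y r hr => by
    have := hs y r hr
    simp only
    linarith⟩
  have := smul_mem_minorantCone (inv_nonneg.2 ha.le) this
  simpa [ha.ne'] using this

theorem IsGammaZero.exists_minorant (hh : IsGammaZero h) :
    ∃ p : StrongDual ℝ X × ℝ, ((1 : ℝ), p) ∈ minorantCone h := by
  obtain ⟨y, hy⟩ := hh.exists_ne_top
  lift h y to ℝ using ⟨hy, hh.ne_bot y⟩ with ρ hρ
  -- Separating a point directly below the graph over the domain rules out a vertical hyperplane.
  obtain ⟨v, a, s, ha, h1, h2⟩ := hh.exists_separating (x := y) (c := ρ - 1) (by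
    rw [← hρ, EReal.coe_lt_coe_iff]; linarith)
  have h3 := h1 y ρ hρ.ge
  exact ⟨_, mem_minorantCone_of_separating (by nlinarith) h1⟩

theorem IsGammaZero.le_of_forall_minorant (hh : IsGammaZero h) {x : X} {c : ℝ}
    (hc : ∀ (u : StrongDual ℝ X) (b : ℝ), ((1 : ℝ), u, b) ∈ minorantCone h → u x - b ≤ c) :
    h x ≤ c := by
  by_contra! hlt
  obtain ⟨v, a, s, ha, h1, h2⟩ := hh.exists_separating hlt
  rcases ha.eq_or_lt with rfl | ha
  -- Vertical hyperplane: tilt a given minorant by large multiples of it.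
  · obtain ⟨⟨u, b⟩, hp⟩ := hh.exists_minorant
    have h0 : ((0 : ℝ), v, s) ∈ minorantCone h := ⟨le_rfl, fun y r hr => by
      have := h1 y r hr
      simp only
      linarith⟩
    obtain ⟨n, hn⟩ := exists_nat_gt ((c - (u x - b)) / (v x - s))
    rw [div_lt_iff₀ (by linarith)] at hn
    have h4 := add_mem_minorantCone hp (smul_mem_minorantCone (Nat.cast_nonneg n) h0)
    have h5 : ((1 : ℝ), u, b) + (n : ℝ) • ((0 : ℝ), v, s) = ((1 : ℝ), u + (n : ℝ) • v, b + n * s) := by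
      ext <;> simp
    rw [h5] at h4
    have := hc _ _ h4
    simp only [add_apply, smul_apply, smul_eq_mul] at this
    linarith
  · have := hc _ _ (mem_minorantCone_of_separating ha h1)
    simp only [smul_apply, smul_eq_mul, ← mul_sub] at this
    rw [inv_mul_le_iff₀ ha] at this
    linarith

end FenchelMoreau

/-! ### Bounds and weak-star limits of minorants. -/

section Limits

variable {X : Type*} [NormedAddCommGroup X] [NormedSpace ℝ X]

theorem mul_norm_le_of_mem_minorantCone {h : X → EReal} {x₀ : X} {r M : ℝ} (hr : 0 < r)
    (hM : ∀ x ∈ Metric.closedBall x₀ r, h x ≤ M) {p : ℝ × StrongDual ℝ X × ℝ}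
    (hp : p ∈ minorantCone h) : r * ‖p.2.1‖ ≤ p.1 * M + p.2.2 - p.2.1 x₀ := by
  have key : ∀ y : X, ‖y‖ ≤ 1 → r * p.2.1 y ≤ p.1 * M + p.2.2 - p.2.1 x₀ := by
    intro y hy
    have := hp.2 (x₀ + r • y) M (hM _ (by
      rw [mem_closedBall_iff_norm, add_sub_cancel_left, norm_smul, Real.norm_of_nonneg hr.le]
      nlinarith))
    rw [map_add, map_smul, smul_eq_mul] at this
    linarith
  rw [← le_div_iff₀' hr]
  refine ContinuousLinearMap.opNorm_le_of_unit_norm (div_nonneg ?_ hr.le) fun y hy => ?_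
  · simpa using key 0 (by simp)
  · have habs : r * |p.2.1 y| = |r * p.2.1 y| := by rw [abs_mul, abs_of_pos hr]
    rw [le_div_iff₀' hr, Real.norm_eq_abs, habs]
    refine abs_le'.2 ⟨key y hy.le, ?_⟩
    simpa using key (-y) (by simpa using hy.le)

theorem Ultrafilter.exists_tendsto_of_bounded {ι : Type*} (l : Ultrafilter ι)
    {d : ι → ℝ × StrongDual ℝ X × ℝ} {C₁ C₂ C₃ : ℝ} (h1 : ∀ᶠ i in l, |(d i).1| ≤ C₁)
    (h2 : ∀ᶠ i in l, ‖(d i).2.1‖ ≤ C₂) (h3 : ∀ᶠ i in l, |(d i).2.2| ≤ C₃) :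
    ∃ p : ℝ × StrongDual ℝ X × ℝ, Tendsto (fun i => (d i).1) l (𝓝 p.1) ∧
      (∀ x, Tendsto (fun i => (d i).2.1 x) l (𝓝 (p.2.1 x))) ∧
      Tendsto (fun i => (d i).2.2) l (𝓝 p.2.2) := by
  have real : ∀ {g : ι → ℝ} {C : ℝ}, (∀ᶠ i in l, |g i| ≤ C) → ∃ a, Tendsto g l (𝓝 a) := by
    intro g C hg
    obtain ⟨a, -, ha⟩ := (isCompact_Icc (a := -C) (b := C)).ultrafilter_le_nhds (l.map g) (by
      rw [le_principal_iff]
      exact hg.mono fun i hi => abs_le.1 hi)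
    exact ⟨a, ha⟩
  obtain ⟨a, ha⟩ := real h1
  obtain ⟨c, hc⟩ := real h3
  obtain ⟨u, -, hu⟩ := (WeakDual.isCompact_closedBall (𝕜 := ℝ) (0 : StrongDual ℝ X)
    C₂).ultrafilter_le_nhds (l.map fun i => StrongDual.toWeakDual (d i).2.1) (by
      rw [le_principal_iff]
      refine h2.mono fun i hi => ?_
      simpa using hi)
  refine ⟨(a, WeakDual.toStrongDual u, c), ha, fun x => ?_, hc⟩
  exact ((WeakDual.eval_continuous x).tendsto u).comp hu

theorem mem_minorantCone_limsup {f : ℕ → X → EReal} {p : ℝ × StrongDual ℝ X × ℝ}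
    (hp : ∀ N, p ∈ minorantCone (fun x => ⨆ k ≥ N, f k x)) :
    p ∈ minorantCone (fun x => limsup (fun k => f k x) atTop) := by
  refine ⟨(hp 0).1, fun x r hr => ?_⟩
  have h1 : ∀ s > r, p.2.1 x - p.2.2 ≤ p.1 * s := by
    intro s hs
    have h2 : limsup (fun k => f k x) atTop < s := lt_of_le_of_lt hr (EReal.coe_lt_coe_iff.2 hs)
    rw [limsup_eq_iInf_iSup_of_nat, iInf_lt_iff] at h2
    obtain ⟨N, hN⟩ := h2
    exact (hp N).2 x s hN.le
  have h3 : Tendsto (fun s => p.1 * s) (𝓝[>] r) (𝓝 (p.1 * r)) :=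
    ((continuous_const_mul p.1).tendsto r).mono_left nhdsWithin_le_nhds
  exact ge_of_tendsto h3 (eventually_nhdsWithin_of_forall h1)

/-- After the indices in `s` cancel, only minorants of functions below `h` remain. -/
theorem sum_sub_sum_mem_minorantCone {h : X → EReal} {f : ℕ → X → EReal}
    {d : ℕ →₀ ℝ × StrongDual ℝ X × ℝ} (hd : ∀ k, d k ∈ minorantCone (f k)) (s : Finset ℕ)
    (hs : ∀ k ∉ s, f k ≤ h) :
    (d.sum fun _ => id) - ∑ k ∈ s, d k ∈ minorantCone h := by
  classical
  rw [Finsupp.sum_of_support_subset d (s := d.support ∪ s) Finset.subset_union_left _ (by simp)]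
  simp only [id]
  rw [← Finset.sum_sdiff (Finset.subset_union_right (s₁ := d.support) (s₂ := s)),
    add_sub_cancel_right]
  exact sum_mem_minorantCone _ fun k hk =>
    minorantCone_mono (hs k (Finset.mem_sdiff.1 hk).2) (hd k)

/-- The functional on `X × ℝ` whose value at `(x, t)` is `u x - b * t`. -/
def affineFunctional : StrongDual ℝ X × ℝ →ₗ[ℝ] StrongDual ℝ (X × ℝ) where
  toFun p := p.1.comp (ContinuousLinearMap.fst ℝ X ℝ) - p.2 • ContinuousLinearMap.snd ℝ X ℝ
  map_add' p q := by
    ext <;> simp; ring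
  map_smul' c p := by
    ext <;> simp

theorem affineFunctional_apply (p : StrongDual ℝ X × ℝ) (e : X × ℝ) :
    affineFunctional p e = p.1 e.1 - p.2 * e.2 := by
  simp [affineFunctional]

/-- Finitely supported families of minorants of the functions `f k`, of total weight one. -/
def weightedMinorants (f : ℕ → X → EReal) : Set (ℕ →₀ ℝ × StrongDual ℝ X × ℝ) :=
  {d | (∀ k, d k ∈ minorantCone (f k)) ∧ (d.sum fun _ => id).1 = 1}

theorem convex_weightedMinorants (f : ℕ → X → EReal) : Convex ℝ (weightedMinorants f) := by
  intro d hd e he a b ha hb hab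
  refine ⟨fun k => add_mem_minorantCone (smul_mem_minorantCone ha (hd.1 k))
    (smul_mem_minorantCone hb (he.1 k)), ?_⟩
  have h1 := map_add (Finsupp.lsum ℝ fun _ : ℕ => (LinearMap.id : (ℝ × StrongDual ℝ X × ℝ) →ₗ[ℝ] _))
    (a • d) (b • e)
  rw [map_smul, map_smul] at h1
  have h2 := congrArg Prod.fst h1
  simp only [Finsupp.lsum_apply, Prod.fst_add, Prod.smul_fst] at h2
  refine h2.trans ?_
  have h3 := hd.2
  have h4 := he.2
  change a • (d.sum fun _ => id).1 + b • (e.sum fun _ => id).1 = 1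
  rw [h3, h4]
  simpa using hab

theorem single_mem_weightedMinorants {f : ℕ → X → EReal} {k : ℕ} {p : StrongDual ℝ X × ℝ}
    (hp : ((1 : ℝ), p) ∈ minorantCone (f k)) :
    Finsupp.single k ((1 : ℝ), p) ∈ weightedMinorants f := by
  classical
  refine ⟨fun i => ?_, by simp⟩
  rw [Finsupp.single_apply]
  split_ifs with hi
  · exact hi ▸ hp
  · exact zero_mem_minorantCone _

/-- Otherwise some `(y, t)` separates `(φ, β)` from all combinations. Fenchel–Moreau turns the
resulting bound on minorants into a bound on the supremum that `φ - β` violates. -/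
theorem exists_ultrafilter_weightedMinorants {f : ℕ → X → EReal} (hf : ∀ k, IsGammaZero (f k))
    {x₀ : X} (hx₀ : ⨆ k, f k x₀ < ⊤) {φ : StrongDual ℝ X} {β : ℝ}
    (hφ : ((1 : ℝ), φ, β) ∈ minorantCone (fun x => ⨆ k, f k x)) :
    ∃ l : Ultrafilter (ℕ →₀ ℝ × StrongDual ℝ X × ℝ), (∀ᶠ d in l, d ∈ weightedMinorants f) ∧
      (∀ x, Tendsto (fun d : ℕ →₀ ℝ × StrongDual ℝ X × ℝ => (d.sum fun _ => id).2.1 x) l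
        (𝓝 (φ x))) ∧
      Tendsto (fun d : ℕ →₀ ℝ × StrongDual ℝ X × ℝ => (d.sum fun _ => id).2.2) l (𝓝 β) := by
  set g : (ℕ →₀ ℝ × StrongDual ℝ X × ℝ) →ₗ[ℝ] StrongDual ℝ (X × ℝ) :=
    affineFunctional ∘ₗ LinearMap.snd ℝ ℝ (StrongDual ℝ X × ℝ) ∘ₗ
      Finsupp.lsum ℝ fun _ : ℕ => (LinearMap.id : (ℝ × StrongDual ℝ X × ℝ) →ₗ[ℝ] _) with hg
  have hgd : ∀ d e, g d e = (d.sum fun _ => id).2.1 e.1 - (d.sum fun _ => id).2.2 * e.2 :=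
    fun d e => affineFunctional_apply _ _
  have hgs : ∀ k p, g (Finsupp.single k ((1 : ℝ), p)) = affineFunctional p := by
    intro k p
    simp [hg]
  have hmem : StrongDual.toWeakDual (affineFunctional (φ, β)) ∈
      closure (StrongDual.toWeakDual '' (g '' weightedMinorants f)) := by
    by_contra hcl
    obtain ⟨⟨y, t⟩, c, h1, h2⟩ := exists_separating_eval
      ((convex_weightedMinorants f).linear_image g) hcl
    rw [affineFunctional_apply] at h2
    have h3 : ∀ k (u : StrongDual ℝ X) (b : ℝ), ((1 : ℝ), u, b) ∈ minorantCone (f k) →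
        u y - b * t < c := by
      intro k u b hp
      have := h1 _ (Set.mem_image_of_mem g (single_mem_weightedMinorants hp))
      rwa [hgs, affineFunctional_apply] at this
    -- Raising `b` preserves minorants, so `-b * t` must stay bounded above.
    have ht : 0 ≤ t := by
      obtain ⟨⟨u, b⟩, hp⟩ := (hf 0).exists_minorant
      by_contra! hneg
      obtain ⟨n, hn⟩ := exists_nat_gt ((c - (u y - b * t)) / (-t))
      rw [div_lt_iff₀ (by linarith)] at hn
      have := h3 0 u (b + n) ⟨zero_le_one, fun x r hr => by
        have := hp.2 x r hr
        have := Nat.cast_nonneg (α := ℝ) n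
        simp only at *
        linarith⟩
      linarith
    simp only at h2
    rcases ht.eq_or_lt with rfl | ht
    -- Along the ray from `x₀` in direction `y` the supremum grows with slope at most `c < φ y`.
    · obtain ⟨ρ, hρ, -⟩ := EReal.lt_iff_exists_real_btwn.1 hx₀
      obtain ⟨n, hn⟩ := exists_nat_gt ((ρ - φ x₀ + β) / (φ y - c))
      rw [div_lt_iff₀ (by linarith)] at hn
      have h4 : ⨆ k, f k (x₀ + (n : ℝ) • y) ≤ ((ρ + n * c : ℝ) : EReal) := by
        refine iSup_le fun k => (hf k).le_of_forall_minorant fun u b hp => ?_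
        have h5 := hp.2 x₀ ρ ((le_iSup (fun k => f k x₀) k).trans hρ.le)
        have h6 := h3 k u b hp
        have h7 : (n : ℝ) * u y ≤ n * c :=
          mul_le_mul_of_nonneg_left (by linarith) (Nat.cast_nonneg n)
        rw [map_add, map_smul, smul_eq_mul]
        simp only at h5
        linarith
      have h8 := hφ.2 _ _ h4
      rw [map_add, map_smul, smul_eq_mul] at h8
      simp only at h8
      linarith
    · have h4 : ⨆ k, f k (t⁻¹ • y) ≤ ((t⁻¹ * c : ℝ) : EReal) := by
        refine iSup_le fun k => (hf k).le_of_forall_minorant fun u b hp => ?_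
        have h6 := h3 k u b hp
        rw [map_smul, smul_eq_mul, le_inv_mul_iff₀ ht, mul_sub, mul_inv_cancel_left₀ ht.ne']
        linarith
      have h8 := hφ.2 _ _ h4
      rw [map_smul, smul_eq_mul] at h8
      simp only [one_mul] at h8
      rw [le_inv_mul_iff₀ ht, mul_sub, mul_inv_cancel_left₀ ht.ne'] at h8
      linarith
  rw [mem_closure_iff_ultrafilter] at hmem
  obtain ⟨v, hv1, hv2⟩ := hmem
  rw [← Set.image_comp] at hv1
  have hne := comap_inf_principal_neBot_of_image_mem v.neBot hv1
  have hle := Ultrafilter.of_le (comap (StrongDual.toWeakDual ∘ g) v ⊓ 𝓟 (weightedMinorants f))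
  refine ⟨Ultrafilter.of _, le_principal_iff.1 (hle.trans inf_le_right), ?_⟩
  have htend := (tendsto_comap.mono_left (hle.trans inf_le_left)).mono_right hv2
  have heval : ∀ e : X × ℝ, Tendsto (fun d => g d e) _ (𝓝 (affineFunctional (φ, β) e)) :=
    fun e => ((WeakDual.eval_continuous e).tendsto _).comp htend
  simp only [hgd, affineFunctional_apply] at heval
  refine ⟨fun x => ?_, ?_⟩
  · simpa using heval (x, 0)
  · simpa using (heval (0, 1)).neg

end Limits

/-! ### Splitting a minorant of the supremum into a series and a remainder. -/

section Decomposition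

variable {X : Type*} [NormedAddCommGroup X] [NormedSpace ℝ X]

theorem exists_minorant_sequence {f : ℕ → X → EReal} (hf : ∀ k, IsGammaZero (f k))
    {x₀ : X} {r M : ℝ} (hr : 0 < r) (hM : ∀ x ∈ Metric.closedBall x₀ r, ⨆ k, f k x ≤ (M : EReal))
    {φ : StrongDual ℝ X} {β : ℝ} (hφ : ((1 : ℝ), φ, β) ∈ minorantCone (fun x => ⨆ k, f k x)) :
    ∃ d : ℕ → ℝ × StrongDual ℝ X × ℝ, (∀ k, d k ∈ minorantCone (f k)) ∧
      ∀ N, ((1 : ℝ), φ, β) - ∑ k ∈ Finset.range N, d k ∈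
        minorantCone (fun x => ⨆ k ≥ N, f k x) := by
  obtain ⟨l, hl, hlφ, hlβ⟩ := exists_ultrafilter_weightedMinorants hf (x₀ := x₀)
    ((hM x₀ (Metric.mem_closedBall_self hr.le)).trans_lt (EReal.coe_lt_top M)) hφ
  set C : ℝ := M + (β + 1) - (φ x₀ - 1) with hC
  have hfM : ∀ k, ∀ x ∈ Metric.closedBall x₀ r, f k x ≤ M :=
    fun k x hx => (le_iSup (fun k => f k x) k).trans (hM x hx)
  have hbound : ∀ k, ∀ᶠ d in (l : Filter (ℕ →₀ ℝ × StrongDual ℝ X × ℝ)), |(d k).1| ≤ 1 ∧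
      ‖(d k).2.1‖ ≤ C / r ∧ |(d k).2.2| ≤ C + |M| + C / r * ‖x₀‖ := by
    intro k
    filter_upwards [hl, (hlφ x₀).eventually_const_lt (sub_one_lt (φ x₀)),
      hlβ.eventually_lt_const (lt_add_one β)] with d hd h1 h2
    -- The norm estimate holds for `d k` and for the rest of the sum; the two right-hand sides are
    -- nonnegative and add up to at most `C`.
    have h3 := sum_sub_sum_mem_minorantCone (h := fun x => ⨆ k, f k x) hd.1 {k}
      (fun i _ x => le_iSup (fun i => f i x) i)
    rw [Finset.sum_singleton] at h3
    have h4 := mul_norm_le_of_mem_minorantCone hr hM h3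
    have h5 := mul_norm_le_of_mem_minorantCone hr (hfM k) (hd.1 k)
    have h6 := mul_nonneg hr.le (norm_nonneg (d k).2.1)
    have h7 := mul_nonneg hr.le (norm_nonneg ((d.sum fun _ => id) - d k).2.1)
    have h8 := (hd.1 k).1
    have h9 : 0 ≤ (d.sum fun _ => id).1 - (d k).1 := h3.1
    have h10 := hd.2
    simp only [Prod.snd_sub, Prod.fst_sub, sub_apply, h10] at h4 h7 h9
    have h11 : ‖(d k).2.1‖ ≤ C / r := by
      rw [le_div_iff₀' hr]
      linarith
    have h12 : |(d k).2.1 x₀| ≤ C / r * ‖x₀‖ :=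
      ((d k).2.1.le_opNorm x₀).trans (mul_le_mul_of_nonneg_right h11 (norm_nonneg _))
    have h13 : |(d k).1 * M| ≤ |M| := by
      rw [abs_mul, abs_of_nonneg h8]
      exact mul_le_of_le_one_left (abs_nonneg M) (by linarith)
    refine ⟨abs_le.2 ⟨by linarith, by linarith⟩, h11, ?_⟩
    rw [abs_le] at h12 h13 ⊢
    constructor <;> linarith
  choose d hd1 hd2 hd3 using fun k => l.exists_tendsto_of_bounded
    ((hbound k).mono fun _ h => h.1) ((hbound k).mono fun _ h => h.2.1)
    ((hbound k).mono fun _ h => h.2.2)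
  refine ⟨d, fun k => mem_minorantCone_of_tendsto (hl.mono fun e he => he.1 k) (hd1 k) (hd2 k)
    (hd3 k), fun N => ?_⟩
  refine mem_minorantCone_of_tendsto (l := (l : Filter (ℕ →₀ ℝ × StrongDual ℝ X × ℝ)))
    (d := fun e => (e.sum fun _ => id) - ∑ k ∈ Finset.range N, e k)
    (hl.mono fun e he => sum_sub_sum_mem_minorantCone he.1 _ fun k hk x => ?_) ?_ (fun x => ?_) ?_
  · exact le_iSup₂ (f := fun i (_ : i ≥ N) => f i x) k (by simpa using hk)
  · simp only [Prod.fst_sub, Prod.fst_sum]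
    refine Tendsto.sub ?_ (tendsto_finsetSum _ fun k _ => hd1 k)
    exact tendsto_const_nhds.congr' (hl.mono fun e he => he.2.symm)
  · simp only [Prod.fst_sub, Prod.fst_sum, Prod.snd_sub, Prod.snd_sum, sub_apply,
      sum_apply]
    exact (hlφ x).sub (tendsto_finsetSum _ fun k _ => hd2 k x)
  · simp only [Prod.snd_sub, Prod.snd_sum]
    exact hlβ.sub (tendsto_finsetSum _ fun k _ => hd3 k)

/-- The norms are dominated by the nonnegative slacks `l * M + b - u x₀`, whose partial sums stay
below the slack of `p` because the remainders have nonnegative slack too. -/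
theorem summable_of_tails_mem_minorantCone {f : ℕ → X → EReal} {x₀ : X} {r M : ℝ} (hr : 0 < r)
    (hM : ∀ x ∈ Metric.closedBall x₀ r, ⨆ k, f k x ≤ (M : EReal)) {p : ℝ × StrongDual ℝ X × ℝ}
    {d : ℕ → ℝ × StrongDual ℝ X × ℝ} (hd : ∀ k, d k ∈ minorantCone (f k))
    (hp : ∀ N, p - ∑ k ∈ Finset.range N, d k ∈ minorantCone (fun x => ⨆ k ≥ N, f k x)) :
    Summable d := by
  have hfM : ∀ k, ∀ x ∈ Metric.closedBall x₀ r, f k x ≤ M :=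
    fun k x hx => (le_iSup (fun k => f k x) k).trans (hM x hx)
  have h1 : Summable fun k => (d k).1 := by
    refine summable_of_sum_range_le (c := p.1) (fun k => (hd k).1) fun N => ?_
    have := (hp N).1
    simp only [Prod.fst_sub, Prod.fst_sum] at this
    linarith
  have hw0 := fun k => mul_norm_le_of_mem_minorantCone hr (hfM k) (hd k)
  have hw1 : ∀ k, 0 ≤ (d k).1 * M + (d k).2.2 - (d k).2.1 x₀ :=
    fun k => (mul_nonneg hr.le (norm_nonneg _)).trans (hw0 k)
  have hw : Summable fun k => (d k).1 * M + (d k).2.2 - (d k).2.1 x₀ := by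
    refine summable_of_sum_range_le (c := p.1 * M + p.2.2 - p.2.1 x₀) hw1 fun N => ?_
    have h2 := mul_norm_le_of_mem_minorantCone hr
      (fun x hx => (iSup₂_le fun k _ => hfM k x hx : ⨆ k ≥ N, f k x ≤ (M : EReal))) (hp N)
    have h3 := (mul_nonneg hr.le (norm_nonneg _)).trans h2
    simp only [Prod.fst_sub, Prod.fst_sum, Prod.snd_sub, Prod.snd_sum, sub_apply,
      sum_apply] at h3
    rw [Finset.sum_sub_distrib, Finset.sum_add_distrib, ← Finset.sum_mul]
    linarith
  have hu : Summable fun k => (d k).2.1 :=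
    Summable.of_norm_bounded (hw.mul_left r⁻¹) fun k => by
      rw [le_inv_mul_iff₀ hr]
      exact hw0 k
  have hux : Summable fun k => (d k).2.1 x₀ :=
    hu.mapL (ContinuousLinearMap.apply ℝ ℝ x₀)
  have hb : Summable fun k => (d k).2.2 :=
    ((hw.add hux).sub (h1.mul_right M)).congr fun k => by ring
  exact (h1.hasSum.prodMk (hu.hasSum.prodMk hb.hasSum)).summable

end Decomposition

/-! ### The biconjugate of the supremum. -/

section BiconjugateOfSupremum

variable {X : Type*} [NormedAddCommGroup X] [NormedSpace ℝ X] {f : ℕ → X → EReal}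

theorem convex_effDom_iSup (hf : ∀ k, IsGammaZero (f k)) :
    Convex ℝ (effDom fun x => ⨆ k, f k x) := by
  have h1 : epi (fun x => ⨆ k, f k x) = ⋂ k, epi (f k) := by
    ext p
    simp [epi, iSup_le_iff]
  have h2 : effDom (fun x => ⨆ k, f k x) =
      LinearMap.fst ℝ X ℝ '' epi (fun x => ⨆ k, f k x) := by
    ext x
    constructor
    · intro hx
      obtain ⟨ρ, hρ, -⟩ := EReal.lt_iff_exists_real_btwn.1 (show ⨆ k, f k x < ⊤ from hx)
      exact ⟨(x, ρ), hρ.le, rfl⟩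
    · rintro ⟨⟨y, ρ⟩, hy, rfl⟩
      exact lt_of_le_of_lt hy (EReal.coe_lt_top ρ)
  rw [h2, h1]
  exact (convex_iInter fun k => (hf k).convex_epi).linear_image _

theorem FiniteContinuousAt.exists_closedBall_le {E : Type*} [PseudoMetricSpace E] {h : E → EReal}
    {x₀ : E}
    (hx₀ : FiniteContinuousAt h x₀) :
    ∃ r > 0, ∃ M : ℝ, ∀ x ∈ Metric.closedBall x₀ r, h x ≤ M := by
  obtain ⟨M, hM, -⟩ := EReal.lt_iff_exists_real_btwn.1 hx₀.2.1.lt_top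
  obtain ⟨r, hr, hball⟩ := Metric.nhds_basis_closedBall.mem_iff.1
    (hx₀.2.2.eventually_lt_const hM)
  exact ⟨r, hr, M, fun x hx => (hball hx).le⟩

theorem biconj_iSup_le_of_mem_wStarClosure (hf : ∀ k, IsGammaZero (f k)) {x₀ : X} {r M : ℝ}
    (hr : 0 < r) (hM : ∀ x ∈ Metric.closedBall x₀ r, ⨆ k, f k x ≤ (M : EReal))
    {z : StrongDual ℝ (StrongDual ℝ X)} (hz : z ∈ wStarClosure (effDom fun x => ⨆ k, f k x))
    {a : ℝ} (ha : ∀ k, biconj (f k) z ≤ a)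
    (ha' : biconj (fun x => limsup (fun k => f k x) atTop) z ≤ a) :
    biconj (fun x => ⨆ k, f k x) z ≤ a := by
  refine iSup_le fun φ => ?_
  rw [EReal.sub_le_iff_le_add (Or.inr (EReal.coe_ne_top a)) (Or.inr (EReal.coe_ne_bot a)), add_comm,
    ← EReal.sub_le_iff_le_add (Or.inl (EReal.coe_ne_bot a)) (Or.inl (EReal.coe_ne_top a)),
    ← EReal.coe_sub]
  refine EReal.le_of_forall_lt_iff_le.1 fun β hβ => ?_
  rw [EReal.coe_le_coe_iff]
  obtain ⟨d, hd, hT⟩ := exists_minorant_sequence hf hr hM (mem_minorantCone_of_conj_le hβ.le)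
  have hsum := summable_of_tails_mem_minorantCone hr hM hd hT
  have hlim := hsum.hasSum.tendsto_sum_nat.const_sub ((1 : ℝ), φ, β)
  set T := ((1 : ℝ), φ, β) - ∑' k, d k with hTdef
  have hTmem : T ∈ minorantCone (fun x => limsup (fun k => f k x) atTop) := by
    refine mem_minorantCone_limsup fun N => mem_minorantCone_of_tendsto (l := atTop)
      (d := fun n => ((1 : ℝ), φ, β) - ∑ k ∈ Finset.range n, d k) ?_ ?_ (fun x => ?_) ?_
    · filter_upwards [eventually_ge_atTop N] with n hn
      exact minorantCone_mono (fun x => biSup_mono fun k hk => le_trans hn hk) (hT n)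
    · exact (continuous_fst.tendsto T).comp hlim
    · exact (((ContinuousLinearMap.apply ℝ ℝ x).continuous.comp
        (continuous_fst.comp continuous_snd)).tendsto T).comp hlim
    · exact ((continuous_snd.comp continuous_snd).tendsto T).comp hlim
  set A := effDom fun x => ⨆ k, f k x with hA
  -- The excess at `z` over `a` times the weight: nonpositive on every piece and norm continuous, so
  -- it passes through the series.
  set L : (ℝ × StrongDual ℝ X × ℝ) →L[ℝ] ℝ :=
    z.comp ((ContinuousLinearMap.fst ℝ _ _).comp (ContinuousLinearMap.snd ℝ _ _)) -
      (ContinuousLinearMap.snd ℝ _ _).comp (ContinuousLinearMap.snd ℝ _ _) -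
      a • ContinuousLinearMap.fst ℝ _ _ with hL
  have hLapp : ∀ p, L p = z p.2.1 - p.2.2 - a * p.1 := fun p => by simp [hL]
  have hLd : ∀ k, L (d k) ≤ 0 := by
    intro k
    have := apply_sub_le_of_mem_minorantCone (A := A)
      (fun x hx => lt_of_le_of_lt (le_iSup (fun k => f k x) k) hx) hz (ha k) (hd k)
    rw [hLapp]
    linarith
  have hLT : L T ≤ 0 := by
    have := apply_sub_le_of_mem_minorantCone (A := A)
      (fun x hx => (limsup_le_iSup : limsup (fun k => f k x) atTop ≤ ⨆ k, f k x).trans_lt hx)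
      hz ha' hTmem
    rw [hLapp]
    linarith
  have hLsum : L (∑' k, d k) ≤ 0 := by
    rw [L.map_tsum hsum]
    exact tsum_nonpos hLd
  have hfin : L ((1 : ℝ), φ, β) ≤ 0 := by
    have : ((1 : ℝ), φ, β) = T + ∑' k, d k := by rw [hTdef, sub_add_cancel]
    rw [this, map_add]
    linarith
  rw [hLapp] at hfin
  simp only at hfin
  linarith

end BiconjugateOfSupremum

theorem theorem3p12 {X : Type*} [NormedAddCommGroup X] [NormedSpace ℝ X] [CompleteSpace X]
    (f : ℕ → X → EReal) (hf : ∀ k, IsGammaZero (f k))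
    (hcont : ∃ x₀ : X, FiniteContinuousAt (fun x => ⨆ k, f k x) x₀)
    (z : StrongDual ℝ (StrongDual ℝ X)) :
    biconj (fun x => ⨆ k, f k x) z =
      max (⨆ k, biconj (f k) z) (biconj (fun x => limsup (fun k => f k x) atTop) z) +
        indicatorFun (wStarClosure (effDom (fun x => ⨆ k, f k x))) z := by
  obtain ⟨x₀, hx₀⟩ := hcont
  obtain ⟨r, hr, M, hM⟩ := hx₀.exists_closedBall_le
  have hle : ∀ k, f k ≤ fun x => ⨆ k, f k x := fun k x => le_iSup (fun k => f k x) k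
  obtain ⟨p, hp⟩ := (hf 0).exists_minorant
  by_cases hz : z ∈ wStarClosure (effDom (fun x => ⨆ k, f k x))
  · rw [indicatorFun, if_pos hz, add_zero]
    refine le_antisymm (EReal.le_of_forall_lt_iff_le.1 fun a ha => ?_)
      (max_le (iSup_le fun k => biconj_mono (hle k) z) (biconj_mono (fun x => limsup_le_iSup) z))
    exact biconj_iSup_le_of_mem_wStarClosure hf hr hM hz
      (fun k => (le_iSup (fun k => biconj (f k) z) k).trans ((le_max_left _ _).trans ha.le))
      ((le_max_right _ _).trans ha.le)
  · rw [indicatorFun, if_neg hz, EReal.add_top_of_ne_bot]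
    · exact biconj_eq_top_of_notMem (convex_effDom_iSup hf) (minorantCone_mono (hle 0) hp) hz
    -- Adding `⊤` gives `⊤` only if the maximum is not `⊥`, which a minorant of `f 0` ensures.
    · refine ne_of_gt (lt_of_lt_of_le (EReal.bot_lt_coe (z p.1 - p.2)) ?_)
      exact (le_biconj_of_mem_minorantCone hp z).trans
        ((le_iSup (fun k => biconj (f k) z) 0).trans (le_max_left _ _))
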